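/- All graphs are finite and simple. For a graph $G$ let $Q(G)=D(G)+A(G)$ be its signless Laplacian matrix, where $D(G)$ is the diagonal matrix of vertex degrees and $A(G)$ is the adjacency matrix, and let $q(G)$ denote the largest eigenvalue of $Q(G)$. A cactus is a connected graph in which any two distinct cycles have at most one common vertex. For integers $s,k\ge 0$ let $H_s^k$ be the graph on $2s+k+1$ vertices that consists of $s$ triangles and $k$ pendant edges, all of which share one common vertex $v_0$ and are otherwise disjoint. Theorem. Let $G$ be a cactus on $n\ge 3$ vertices. (i) If $n$ is odd, then $$q(G)\le \frac{(n+2)+\sqrt{n^2-4n+12}}{2},$$ with equality if and only if $G\cong H_{(n-1)/2}^{0}$. (ii) If $n$ is even, then $$q(G)\le \frac{(n+1)+\sqrt{n^2-2n+9}}{2},$$ with equality if and only if $G\cong H_{n/2-1}^{1}$. -/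

import Mathlib

namespace SimpleGraph

/-- A graph is a cactus if it is connected and any two distinct cycles (as subgraphs) have at most
one common vertex. -/
def IsCactus {V : Type*} (G : SimpleGraph V) : Prop :=
  G.Connected ∧
    ∀ ⦃u v : V⦄ (p : G.Walk u u) (q : G.Walk v v), p.IsCycle → q.IsCycle →
      p.toSubgraph ≠ q.toSubgraph → {w | w ∈ p.support ∧ w ∈ q.support}.Subsingleton

section SignlessLaplacian

variable {V : Type*} [Fintype V] [DecidableEq V] (G : SimpleGraph V) [DecidableRel G.Adj]

/-- The signless Laplacian matrix `Q(G) = D(G) + A(G)`, with real entries. -/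
def signlessLapMatrix : Matrix V V ℝ := G.degMatrix ℝ + G.adjMatrix ℝ

theorem isHermitian_signlessLapMatrix : G.signlessLapMatrix.IsHermitian :=
  (G.isHermitian_degMatrix ℝ).add (G.isHermitian_adjMatrix ℝ)

/-- The signless Laplacian spectral radius `q(G)`: the largest eigenvalue of `Q(G)`. -/
noncomputable def signlessLapRadius : ℝ := ⨆ i : V, G.isHermitian_signlessLapMatrix.eigenvalues i

/-- On a nonempty vertex set `q(G)` is indeed the greatest eigenvalue of `Q(G)`. -/
theorem isGreatest_signlessLapRadius [Nonempty V] :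
    IsGreatest {μ : ℝ | Module.End.HasEigenvalue (Matrix.toLin' G.signlessLapMatrix) μ}
      G.signlessLapRadius := by
  have h : {μ : ℝ | Module.End.HasEigenvalue (Matrix.toLin' G.signlessLapMatrix) μ} =
      Set.range G.isHermitian_signlessLapMatrix.eigenvalues := by
    rw [← Matrix.IsHermitian.spectrum_real_eq_range_eigenvalues, ← Matrix.spectrum_toLin']
    ext μ
    exact Module.End.hasEigenvalue_iff_mem_spectrum
  rw [h]
  refine ⟨?_, ?_⟩
  · obtain ⟨i, hi⟩ := exists_eq_ciSup_of_finite
      (f := G.isHermitian_signlessLapMatrix.eigenvalues)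
    exact ⟨i, hi⟩
  · rintro _ ⟨i, rfl⟩
    exact le_ciSup (Set.finite_range G.isHermitian_signlessLapMatrix.eigenvalues).bddAbove i

end SignlessLaplacian

/-- The graph `H_s^k` on `2 * s + k + 1` vertices: `s` triangles and `k` pendant edges, all sharing
exactly the vertex `none`. The `i`-th triangle has the further vertices `inl (i, false)` and
`inl (i, true)`, and the `j`-th pendant vertex is `inr j`. -/
def triangleBundle (s k : ℕ) : SimpleGraph (Option ((Fin s × Bool) ⊕ Fin k)) where
  Adj
    | none, none => False
    | none, some _ => True
    | some _, none => True
    | some (.inl a), some (.inl b) => a.1 = b.1 ∧ a.2 ≠ b.2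
    | some (.inl _), some (.inr _) => False
    | some (.inr _), some (.inl _) => False
    | some (.inr _), some (.inr _) => False
  symm := ⟨by
    rintro (_ | a | a) (_ | b | b) h <;> first | exact h | exact ⟨h.1.symm, h.2.symm⟩⟩
  loopless := ⟨by
    rintro (_ | a | a) h
    · exact h
    · exact h.2 rfl
    · exact h⟩

end SimpleGraph

/-! Take a nonzero y ≥ 0 whose Rayleigh quotient is at least q(G), root G at a vertex r where y is
largest, and give every other vertex u a parent p u, a neighbour closer to r. In a cactus the
remaining edges form a matching that misses r (`IsCactus.nonParentGraph_adj_unique`). Estimating (y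
u + y w)² ≤ 2 (y u)² + 2 (y w)² on these edges only, the quadratic form is at most the sum over u ≠
r of (y u + y (p u))² + 2 c u (y u)², with c u the degree of u in the matching
(`IsDistParent.sum_edges_le`).

Now y (p u) ≤ y r and c u ≤ b u, where b is 0 on k chosen unmatched vertices and 1 elsewhere; k = 1
is possible for even n because a matching covers evenly many vertices. Completing squares bounds the
sum by lam ∑ (y v)² as soon as ∑ (1 + 1/(lam - 1 - 2 b u)) = lam (`eq_of_le_weighted_sum`). This is
also the eigenvalue equation at the centre of the bundle, so the bound is attained there.
Conversely, equality makes r the parent of every other vertex, which yields the bundle. -/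

namespace SimpleGraph

open Finset

/-! ### Distance trees in a cactus -/

section Parent

variable {V : Type*} {G : SimpleGraph V}

/-- `p` sends every vertex other than `r` to a neighbour that is closer to `r`. -/
def IsDistParent (G : SimpleGraph V) (r : V) (p : V → V) : Prop :=
  ∀ u, u ≠ r → G.Adj u (p u) ∧ G.dist r (p u) + 1 = G.dist r u

theorem Connected.exists_isDistParent (hG : G.Connected) (r : V) :
    ∃ p : V → V, G.IsDistParent r p := by
  have h : ∀ u, ∃ w, u ≠ r → G.Adj u w ∧ G.dist r w + 1 = G.dist r u := by
    intro u
    by_cases hu : u = r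
    · exact ⟨u, fun h => absurd hu h⟩
    obtain ⟨q, hq⟩ := hG.exists_walk_length_eq_dist u r
    cases q with
    | nil => exact absurd rfl hu
    | @cons _ w _ h q =>
      refine ⟨w, fun _ => ⟨h, ?_⟩⟩
      rw [Walk.length_cons, dist_comm] at hq
      have h1 : G.dist w r ≤ q.length := dist_le q
      rw [dist_comm] at h1
      have h2 : G.dist r u ≤ G.dist r w + G.dist w u := hG.dist_triangle
      rw [dist_eq_one_iff_adj.2 h.symm] at h2
      omega
  choose p hp using h
  exact ⟨p, hp⟩

/-- The edges of `G` that do not join a vertex to its image under `p`. -/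
def nonParentGraph (G : SimpleGraph V) (p : V → V) : SimpleGraph V where
  Adj u w := G.Adj u w ∧ p u ≠ w ∧ p w ≠ u
  symm := ⟨fun _ _ h => ⟨h.1.symm, h.2.2, h.2.1⟩⟩
  loopless := ⟨fun _ h => G.loopless.irrefl _ h.1⟩

variable {r : V} {p : V → V}

theorem IsDistParent.not_adj_root (hG : G.Connected) (hp : G.IsDistParent r p) (a : V) :
    ¬ (G.nonParentGraph p).Adj r a := by
  rintro ⟨h, -, h2⟩
  have h3 := (hp a h.ne').2
  rw [dist_eq_one_iff_adj.2 h] at h3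
  exact h2 ((hG.dist_eq_zero_iff.1 (by omega : G.dist r (p a) = 0)).symm)

/-- Following parents from u lowers the distance to r at each step, so a vertex w at least as far
from r is never met. -/
theorem IsDistParent.exists_walk_of_dist_le (hp : G.IsDistParent r p) (hG : G.Connected) {w : V}
    (hw : w ≠ r) (k : ℕ) :
    ∀ u, u ≠ w → G.dist r u = k → k ≤ G.dist r w → ∃ q : G.Walk u r, w ∉ q.support := by
  induction k with
  | zero =>
    intro u _ hk _
    obtain rfl := hG.dist_eq_zero_iff.1 hk
    exact ⟨Walk.nil, by simpa using hw⟩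
  | succ k ih =>
    intro u hu hk hkw
    have hur : u ≠ r := by rintro rfl; simp at hk
    obtain ⟨h1, h2⟩ := hp u hur
    have hne : p u ≠ w := by rintro h; rw [h] at h2; omega
    obtain ⟨q, hq⟩ := ih (p u) hne (by omega) (by omega)
    refine ⟨Walk.cons h1 q, ?_⟩
    rw [Walk.support_cons, List.mem_cons, not_or]
    exact ⟨hu.symm, hq⟩

/-- If a is farther from r than w, one step to its parent, which is not w, brings it no farther than
w. -/
theorem IsDistParent.exists_walk_of_adj (hp : G.IsDistParent r p) (hG : G.Connected) {w a : V}
    (hw : w ≠ r) (h : (G.nonParentGraph p).Adj w a) : ∃ q : G.Walk a r, w ∉ q.support := by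
  by_cases hd : G.dist r a ≤ G.dist r w
  · exact hp.exists_walk_of_dist_le hG hw _ a h.1.ne' rfl hd
  have har : a ≠ r := by rintro rfl; simp at hd
  obtain ⟨h1, h2⟩ := hp a har
  have h3 : G.dist r a ≤ G.dist r w + G.dist w a := hG.dist_triangle
  rw [dist_eq_one_iff_adj.2 h.1] at h3
  obtain ⟨q, hq⟩ := hp.exists_walk_of_dist_le hG hw _ (p a) h.2.2 rfl (by omega)
  refine ⟨Walk.cons h1 q, ?_⟩
  rw [Walk.support_cons, List.mem_cons, not_or]
  exact ⟨h.1.ne, hq⟩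

/-- Both p w and a reach r without meeting w; joining these walks and closing up through w gives a
cycle. Its edges at w are recorded because they determine a. -/
theorem IsDistParent.exists_cycle (hp : G.IsDistParent r p) (hG : G.Connected) {w a : V}
    (hw : w ≠ r) (h : (G.nonParentGraph p).Adj w a) :
    ∃ c : G.Walk w w, c.IsCycle ∧ p w ∈ c.support ∧
      ∀ b, s(w, b) ∈ c.edges ↔ b = p w ∨ b = a := by
  classical
  obtain ⟨q₁, hq₁⟩ := hp.exists_walk_of_adj hG hw h
  obtain ⟨hadj, hdist⟩ := hp w hw
  obtain ⟨q₂, hq₂⟩ := hp.exists_walk_of_dist_le hG hw _ (p w) hadj.ne' rfl (by omega)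
  set P := (q₂.append q₁.reverse).bypass with hP
  have hwP : w ∉ P.support := by
    intro hmem
    have := Walk.support_bypass_subset_support _ hmem
    rw [Walk.mem_support_append_iff, Walk.support_reverse, List.mem_reverse] at this
    tauto
  have hedge : ∀ b, s(w, b) ∉ P.edges := fun b hb => hwP (P.fst_mem_support_of_mem_edges hb)
  have hpath : P.IsPath := Walk.bypass_isPath _
  refine ⟨Walk.cons hadj (P.concat h.1.symm), ?_, ?_, ?_⟩
  · rw [Walk.cons_isCycle_iff]
    refine ⟨hpath.concat hwP _, ?_⟩
    rw [Walk.edges_concat, List.concat_eq_append, List.mem_append]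
    rintro (h' | h')
    · exact hedge _ h'
    · have h2 := h.2.1
      have h3 := h.1.ne
      simp at h'
      grind
  · simp
  · intro b
    have h3 := h.1.ne
    have := hedge b
    simp only [Walk.edges_cons, Walk.edges_concat, List.concat_eq_append, List.mem_append,
      List.mem_cons, List.not_mem_nil, or_false, this, false_or, Sym2.eq_iff]
    grind

/-- Two non-parent edges at w would give distinct cycles sharing both w and p w. -/
theorem IsCactus.nonParentGraph_adj_unique (hG : G.IsCactus) (hp : G.IsDistParent r p) {w a b : V}
    (ha : (G.nonParentGraph p).Adj w a) (hb : (G.nonParentGraph p).Adj w b) : a = b := by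
  have hw : w ≠ r := by
    rintro rfl
    exact hp.not_adj_root hG.1 a ha
  obtain ⟨c, hc, hcp, hce⟩ := hp.exists_cycle hG.1 hw ha
  obtain ⟨d, hd, hdp, hde⟩ := hp.exists_cycle hG.1 hw hb
  by_contra hab
  have hne : c.toSubgraph ≠ d.toSubgraph := by
    intro heq
    have h1 : s(w, b) ∈ d.toSubgraph.edgeSet := by
      rw [Walk.mem_edges_toSubgraph]
      exact (hde b).2 (Or.inr rfl)
    rw [← heq, Walk.mem_edges_toSubgraph, hce] at h1
    rcases h1 with h1 | h1
    · exact hb.2.1 h1.symm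
    · exact hab h1.symm
  exact (hp w hw).1.ne (hG.2 c d hc hd hne ⟨c.start_mem_support, d.start_mem_support⟩ ⟨hcp, hdp⟩)

end Parent

/-! ### Matchings, parity and recognition of the bundle -/

section Matching

variable {V : Type*} [Fintype V] (M : SimpleGraph V) [DecidableRel M.Adj]

theorem degree_le_one_of_adj_unique (hM : ∀ ⦃w a b⦄, M.Adj w a → M.Adj w b → a = b) (u : V) :
    M.degree u ≤ 1 := by
  rw [← card_neighborFinset_eq_degree, Finset.card_le_one]
  intro a ha b hb
  rw [mem_neighborFinset] at ha hb
  exact hM ha hb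

theorem even_card_degree_eq_one (hM : ∀ u, M.degree u ≤ 1) :
    Even #{u | M.degree u = 1} := by
  classical
  have h : ∀ u, M.degree u = 1 ↔ Odd (M.degree u) := by
    intro u
    have := hM u
    constructor
    · intro h; rw [h]; exact odd_one
    · rintro ⟨k, hk⟩; omega
  convert M.even_card_odd_degree_vertices using 3
  exact h _

end Matching

/-- A graph in which `r` is adjacent to all other vertices, and in which every other vertex has at
most one neighbour besides `r`, is a bundle of triangles and pendant edges. -/
theorem nonempty_iso_triangleBundle {V : Type*} [Fintype V] {G : SimpleGraph V} {r : V} {s k : ℕ}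
    (hr : ∀ u, u ≠ r → G.Adj r u)
    (hu : ∀ u a b, u ≠ r → a ≠ r → b ≠ r → G.Adj u a → G.Adj u b → a = b)
    (hk : Nat.card {u // u ≠ r ∧ ∀ a, a ≠ r → ¬ G.Adj u a} = k)
    (hV : Fintype.card V = 2 * s + k + 1) : Nonempty (G ≃g triangleBundle s k) := by
  classical
  let e := Fintype.equivFin V
  let K := {u // u ≠ r ∧ ∀ a, a ≠ r → ¬ G.Adj u a}
  have hm : ∀ u, ∃ w, (u ≠ r ∧ ∃ a, a ≠ r ∧ G.Adj u a) → w ≠ r ∧ G.Adj u w := by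
    intro u
    by_cases h : u ≠ r ∧ ∃ a, a ≠ r ∧ G.Adj u a
    · obtain ⟨a, ha⟩ := h.2
      exact ⟨a, fun _ => ha⟩
    · exact ⟨u, fun h' => absurd h' h⟩
  choose m hm using hm
  -- The numbering `e` selects one end of each matched pair, so that `L` indexes the triangles.
  let L := {u // (u ≠ r ∧ ∃ a, a ≠ r ∧ G.Adj u a) ∧ e u < e (m u)}
  let f : Option ((L × Bool) ⊕ K) → V
    | none => r
    | some (.inl (u, false)) => u.1
    | some (.inl (u, true)) => m u.1
    | some (.inr u) => u.1
  have hmm : ∀ u : V, (u ≠ r ∧ ∃ a, a ≠ r ∧ G.Adj u a) → m (m u) = u := by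
    intro u h
    obtain ⟨h1, h2⟩ := hm u h
    obtain ⟨h3, h4⟩ := hm (m u) ⟨h1, u, h.1, h2.symm⟩
    exact hu (m u) _ _ h1 h3 h.1 h4 h2.symm
  have hadj : ∀ u a : V, (u ≠ r ∧ ∃ a, a ≠ r ∧ G.Adj u a) → a ≠ r → (G.Adj u a ↔ a = m u) := by
    intro u a h ha
    obtain ⟨h1, h2⟩ := hm u h
    exact ⟨fun h' => hu u _ _ h.1 ha h1 h' h2, fun h' => h' ▸ h2⟩
  have hsym : ∀ u : V, (u ≠ r ∧ ∃ a, a ≠ r ∧ G.Adj u a) → G.Adj (m u) u := fun u h =>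
    (hm u h).2.symm
  have hinj : Function.Injective f := by
    rintro (_ | ⟨⟨u, hu⟩, _ | _⟩ | ⟨u, hu⟩) (_ | ⟨⟨v, hv⟩, _ | _⟩ | ⟨v, hv⟩) h <;>
      simp only [f] at h <;> grind
  have hsurj : Function.Surjective f := by
    intro u
    by_cases h1 : u = r
    · exact ⟨none, h1.symm⟩
    by_cases h2 : ∃ a, a ≠ r ∧ G.Adj u a
    · have hne : u ≠ m u := (hm u ⟨h1, h2⟩).2.ne
      rcases lt_or_gt_of_ne (fun h => hne (e.injective h) : e u ≠ e (m u)) with h | h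
      · exact ⟨some (.inl (⟨u, ⟨h1, h2⟩, h⟩, false)), rfl⟩
      · obtain ⟨h3, h4⟩ := hm u ⟨h1, h2⟩
        refine ⟨some (.inl (⟨m u, ⟨h3, u, h1, h4.symm⟩, ?_⟩, true)), hmm u ⟨h1, h2⟩⟩
        rwa [hmm u ⟨h1, h2⟩]
    · push Not at h2
      exact ⟨some (.inr ⟨u, h1, h2⟩), rfl⟩
  have hcard := Fintype.card_of_bijective (f := f) ⟨hinj, hsurj⟩
  rw [Nat.card_eq_fintype_card] at hk
  have hL : Fintype.card L = s := by
    have hK : Fintype.card K = k := hk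
    simp only [Fintype.card_option, Fintype.card_sum, Fintype.card_prod, Fintype.card_bool] at hcard
    omega
  let eL : Fin s ≃ L := (Fintype.equivFinOfCardEq hL).symm
  let eK : Fin k ≃ K := (Fintype.equivFinOfCardEq hk).symm
  let g : Option ((Fin s × Bool) ⊕ Fin k) ≃ V :=
    (Equiv.optionCongr ((eL.prodCongr (Equiv.refl Bool)).sumCongr eK)).trans
      (Equiv.ofBijective f ⟨hinj, hsurj⟩)
  have gn : g none = r := rfl
  have gf : ∀ i, g (some (.inl (i, false))) = (eL i).1 := fun _ => rfl
  have gt : ∀ i, g (some (.inl (i, true))) = m (eL i).1 := fun _ => rfl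
  have gk : ∀ i, g (some (.inr i)) = (eK i).1 := fun _ => rfl
  have hgr : ∀ x, g (some x) ≠ r := fun x h => by
    rw [← gn] at h
    exact absurd (g.injective h) (by simp)
  have hnK : ∀ i x, ¬ G.Adj (g (some (.inr i))) (g (some x)) := fun i x =>
    (eK i).2.2 _ (hgr x)
  have hT : ∀ i b, (g (some (.inl (i, b))) ≠ r ∧ ∃ a, a ≠ r ∧ G.Adj (g (some (.inl (i, b)))) a) ∧
      m (g (some (.inl (i, b)))) = g (some (.inl (i, !b))) := by
    intro i b
    have h := (eL i).2.1
    cases b with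
    | false => exact ⟨h, rfl⟩
    | true => exact ⟨⟨hgr _, (eL i).1, h.1, (hm _ h).2.symm⟩, hmm _ h⟩
  refine ⟨RelIso.symm ⟨g, ?_⟩⟩
  rintro (_ | ⟨i, b⟩ | i) (_ | ⟨j, c⟩ | j)
  · simp [triangleBundle]
  · simpa [triangleBundle, gn] using hr _ (hgr _)
  · simpa [triangleBundle, gn] using hr _ (hgr _)
  · simpa [triangleBundle, gn] using (hr _ (hgr _)).symm
  · rw [hadj _ _ (hT i b).1 (hgr _), (hT i b).2, g.injective.eq_iff]
    simp only [triangleBundle, Option.some.injEq, Sum.inl.injEq, Prod.mk.injEq]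
    cases b <;> cases c <;> simp [eq_comm]
  · exact iff_of_false (fun h => hnK _ _ h.symm) (by simp [triangleBundle])
  · simpa [triangleBundle, gn] using (hr _ (hgr _)).symm
  · exact iff_of_false (fun h => hnK _ _ h) (by simp [triangleBundle])
  · exact iff_of_false (fun h => hnK _ _ h) (by simp [triangleBundle])

/-! ### Rayleigh quotient estimates -/

section Spectral

variable {V : Type*} [Fintype V] [DecidableEq V] (G : SimpleGraph V) [DecidableRel G.Adj]

theorem signlessLapMatrix_mulVec_apply (x : V → ℝ) (v : V) :
    (G.signlessLapMatrix.mulVec x) v = ∑ u, if G.Adj v u then x v + x u else 0 := by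
  rw [signlessLapMatrix, Matrix.add_mulVec, Pi.add_apply, degMatrix, Matrix.mulVec_diagonal,
    adjMatrix_mulVec_apply, ← card_neighborFinset_eq_degree, ← nsmul_eq_mul, ← sum_const,
    ← sum_add_distrib, neighborFinset_eq_filter, sum_filter]

theorem exists_signlessLapRadius_eigenvector [Nonempty V] : ∃ x : V → ℝ, x ≠ 0 ∧
    ∀ v, ∑ u, (if G.Adj v u then x v + x u else 0) = G.signlessLapRadius * x v := by
  obtain ⟨x, hx⟩ := (isGreatest_signlessLapRadius G).1.exists_hasEigenvector
  refine ⟨x, hx.2, fun v => ?_⟩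
  rw [← signlessLapMatrix_mulVec_apply, ← Matrix.toLin'_apply, hx.apply_eq_smul]
  rfl

theorem le_signlessLapRadius_of_eigenvector [Nonempty V] {x : V → ℝ} {μ : ℝ} (hx : x ≠ 0)
    (h : ∀ v, ∑ u, (if G.Adj v u then x v + x u else 0) = μ * x v) :
    μ ≤ G.signlessLapRadius := by
  refine (isGreatest_signlessLapRadius G).2 ?_
  refine Module.End.hasEigenvalue_of_hasEigenvector (x := x) ⟨?_, hx⟩
  rw [Module.End.mem_eigenspace_iff]
  ext v
  rw [Matrix.toLin'_apply, signlessLapMatrix_mulVec_apply, h]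
  rfl

/-- Absolute values of an eigenvector work, by the triangle inequality in the eigenvalue equation.
The factor 2 appears because ordered pairs count each edge twice. -/
theorem exists_nonneg_rayleigh [Nonempty V] : ∃ y : V → ℝ, y ≠ 0 ∧ (∀ v, 0 ≤ y v) ∧
    2 * (G.signlessLapRadius * ∑ v, y v ^ 2) ≤
      ∑ v, ∑ u, if G.Adj v u then (y v + y u) ^ 2 else 0 := by
  obtain ⟨x, hx, h⟩ := G.exists_signlessLapRadius_eigenvector
  refine ⟨fun v => |x v|, ?_, fun v => abs_nonneg _, ?_⟩
  · intro h0
    exact hx (funext fun v => abs_eq_zero.1 (congrFun h0 v))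
  have h1 : ∀ v, G.signlessLapRadius * |x v| ^ 2 ≤
      ∑ u, if G.Adj v u then |x v| * (|x v| + |x u|) else 0 := by
    intro v
    have h2 : G.signlessLapRadius * |x v| ≤ ∑ u, if G.Adj v u then |x v| + |x u| else 0 := by
      calc G.signlessLapRadius * |x v| ≤ |G.signlessLapRadius * x v| := by
            rw [abs_mul]
            exact mul_le_mul_of_nonneg_right (le_abs_self _) (abs_nonneg _)
        _ ≤ _ := by
            rw [← h v]
            refine (abs_sum_le_sum_abs _ _).trans (sum_le_sum fun u _ => ?_)
            split_ifs
            · exact abs_add_le _ _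
            · simp
    calc G.signlessLapRadius * |x v| ^ 2 = |x v| * (G.signlessLapRadius * |x v|) := by ring
      _ ≤ |x v| * ∑ u, if G.Adj v u then |x v| + |x u| else 0 :=
          mul_le_mul_of_nonneg_left h2 (abs_nonneg _)
      _ = _ := by rw [mul_sum]; simp only [mul_ite, mul_zero]
  have h3 := sum_le_sum fun v (_ : v ∈ univ) => h1 v
  rw [← mul_sum] at h3
  have h4 : ∑ v, ∑ u, (if G.Adj v u then |x v| * (|x v| + |x u|) else 0) =
      ∑ v, ∑ u, if G.Adj v u then |x u| * (|x v| + |x u|) else 0 := by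
    rw [sum_comm]
    refine sum_congr rfl fun u _ => sum_congr rfl fun v _ => ?_
    simp only [G.adj_comm v u, add_comm |x v| |x u|]
  have h5 : ∑ v, ∑ u, (if G.Adj v u then (|x v| + |x u|) ^ 2 else 0) =
      ∑ v, ∑ u, (if G.Adj v u then |x v| * (|x v| + |x u|) else 0) +
      ∑ v, ∑ u, if G.Adj v u then |x u| * (|x v| + |x u|) else 0 := by
    simp only [← sum_add_distrib]
    refine sum_congr rfl fun u _ => sum_congr rfl fun v _ => ?_
    split_ifs <;> ring
  linarith

variable {G} {r : V} {p : V → V}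

theorem IsDistParent.sum_edges_le (hp : G.IsDistParent r p) (hG : G.Connected)
    [DecidableRel (G.nonParentGraph p).Adj] (y : V → ℝ) :
    ∑ v, ∑ u, (if G.Adj v u then (y v + y u) ^ 2 else 0) ≤
      2 * ∑ u ∈ univ.erase r,
        ((y u + y (p u)) ^ 2 + 2 * (G.nonParentGraph p).degree u * y u ^ 2) := by
  have hcover : ∀ v u, (if G.Adj v u then (y v + y u) ^ 2 else 0) ≤
      (if v ≠ r then if u = p v then (y v + y u) ^ 2 else 0 else 0) +
      (if u ≠ r then if v = p u then (y u + y v) ^ 2 else 0 else 0) +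
      ((if (G.nonParentGraph p).Adj v u then 2 * y v ^ 2 else 0) + if (G.nonParentGraph p).Adj u v then 2 * y u ^ 2 else 0) := by
    intro v u
    have hsq : (y v + y u) ^ 2 ≤ 2 * y v ^ 2 + 2 * y u ^ 2 := by nlinarith [sq_nonneg (y v - y u)]
    have n1 : 0 ≤ (if v ≠ r then if u = p v then (y v + y u) ^ 2 else 0 else 0) := by
      split_ifs <;> positivity
    have n2 : 0 ≤ (if u ≠ r then if v = p u then (y u + y v) ^ 2 else 0 else 0) := by
      split_ifs <;> positivity
    have n3 : 0 ≤ (if (G.nonParentGraph p).Adj v u then 2 * y v ^ 2 else 0) := by split_ifs <;> positivity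
    have n4 : 0 ≤ (if (G.nonParentGraph p).Adj u v then 2 * y u ^ 2 else 0) := by split_ifs <;> positivity
    by_cases h : G.Adj v u
    swap
    · rw [if_neg h]; positivity
    rw [if_pos h]
    by_cases hM : (G.nonParentGraph p).Adj v u
    · rw [if_pos hM, if_pos hM.symm]; linarith
    by_cases h1 : v ≠ r ∧ u = p v
    · rw [if_pos h1.1, if_pos h1.2]; linarith
    by_cases h2 : u ≠ r ∧ v = p u
    · rw [if_pos h2.1, if_pos h2.2]; linarith
    -- Every edge at r is a parent edge, since the parent of a neighbour of r has distance 0 from r.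
    exfalso
    by_cases hv : v = r
    · have hu : u ≠ r := hv ▸ h.ne'
      have := (hp u hu).2
      rw [← hv, dist_eq_one_iff_adj.2 h] at this
      exact h2 ⟨hu, hG.dist_eq_zero_iff.1 (by omega)⟩
    by_cases hu : u = r
    · have := (hp v hv).2
      rw [← hu, dist_eq_one_iff_adj.2 h.symm] at this
      exact h1 ⟨hv, hG.dist_eq_zero_iff.1 (by omega)⟩
    exact hM ⟨h, fun h' => h1 ⟨hv, h'.symm⟩, fun h' => h2 ⟨hu, h'.symm⟩⟩
  have hdeg : ∑ v, ∑ u, (if (G.nonParentGraph p).Adj v u then 2 * y v ^ 2 else 0) =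
      ∑ u ∈ univ.erase r, 2 * (G.nonParentGraph p).degree u * y u ^ 2 := by
    have h0 : ∀ v, ∑ u, (if (G.nonParentGraph p).Adj v u then 2 * y v ^ 2 else 0) = 2 * (G.nonParentGraph p).degree v * y v ^ 2 := by
      intro v
      rw [← sum_filter, ← neighborFinset_eq_filter, sum_const, card_neighborFinset_eq_degree,
        nsmul_eq_mul]
      ring
    simp only [h0]
    rw [← add_sum_erase _ _ (mem_univ r)]
    have : (G.nonParentGraph p).degree r = 0 := by
      rw [← card_neighborFinset_eq_degree, Finset.card_eq_zero, Finset.eq_empty_iff_forall_notMem]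
      intro a ha
      rw [mem_neighborFinset] at ha
      exact hp.not_adj_root hG a ha
    simp [this]
  have hpar : ∑ v, ∑ u, (if v ≠ r then if u = p v then (y v + y u) ^ 2 else 0 else 0) =
      ∑ u ∈ univ.erase r, (y u + y (p u)) ^ 2 := by
    have h0 : ∀ v, ∑ u, (if v ≠ r then if u = p v then (y v + y u) ^ 2 else 0 else 0) =
        if v ≠ r then (y v + y (p v)) ^ 2 else 0 := by
      intro v
      split_ifs <;> simp
    simp only [h0]
    rw [← sum_filter, filter_ne']
  refine (sum_le_sum fun v _ => sum_le_sum fun u _ => hcover v u).trans (le_of_eq ?_)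
  simp only [sum_add_distrib]
  rw [sum_comm (f := fun v u => if u ≠ r then if v = p u then (y u + y v) ^ 2 else 0 else 0),
    sum_comm (f := fun v u => if (G.nonParentGraph p).Adj u v then 2 * y u ^ 2 else 0), hdeg, hpar]
  ring

/-- A weighted comparison of the Rayleigh quotient of a cactus with that of a vertex joined to a
matching, where `b` prescribes the vertices that are covered by the matching. -/
theorem eq_of_le_weighted_sum {ρ lam : ℝ} {y c : V → ℝ} {b : V → ℝ}
    (hy0 : y ≠ 0) (hy : ∀ v, 0 ≤ y v) (hmax : ∀ v, y v ≤ y r)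
    (hle : ρ * ∑ v, y v ^ 2 ≤ ∑ u ∈ univ.erase r, ((y u + y (p u)) ^ 2 + 2 * c u * y u ^ 2))
    (hb : ∀ u, u ≠ r → c u ≤ b u) (hb1 : ∀ u, b u ≤ 1) (hlam : 3 < lam)
    (hsum : ∑ u ∈ univ.erase r, (1 + (lam - 1 - 2 * b u)⁻¹) = lam) :
    ρ ≤ lam ∧ (ρ = lam → 0 < y r ∧ ∀ u, u ≠ r → c u = b u ∧
      y u = (lam - 1 - 2 * b u)⁻¹ * y r ∧ y (p u) = y r) := by
  have hr : 0 < y r := by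
    refine lt_of_le_of_ne (hy r) fun h => hy0 (funext fun v => ?_)
    exact le_antisymm ((hmax v).trans h.symm.le) (hy v)
  have hpos : 0 < ∑ v, y v ^ 2 :=
    sum_pos' (fun v _ => sq_nonneg _) ⟨r, mem_univ _, by positivity⟩
  set d : V → ℝ := fun u => lam - 1 - 2 * b u with hd
  have hdpos : ∀ u, 0 < d u := fun u => by have := hb1 u; simp only [hd]; linarith
  -- The slack at u is a sum of three nonnegative terms, each of which must vanish in the case of
  -- equality.
  have hid : ∀ u, lam * y u ^ 2 + (1 + (d u)⁻¹) * y r ^ 2 -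
      ((y u + y (p u)) ^ 2 + 2 * c u * y u ^ 2) =
      2 * (b u - c u) * y u ^ 2 + d u * (y u - (d u)⁻¹ * y r) ^ 2 +
        (y r - y (p u)) * (2 * y u + y r + y (p u)) := by
    intro u
    have h1 : d u * (d u)⁻¹ = 1 := mul_inv_cancel₀ (hdpos u).ne'
    have h2 : lam = d u + 1 + 2 * b u := by simp only [hd]; ring
    rw [h2]
    linear_combination (2 * y u * y r - (d u)⁻¹ * y r ^ 2) * h1
  have hnn : ∀ u, u ≠ r → 0 ≤ 2 * (b u - c u) * y u ^ 2 ∧ 0 ≤ d u * (y u - (d u)⁻¹ * y r) ^ 2 ∧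
      0 ≤ (y r - y (p u)) * (2 * y u + y r + y (p u)) := by
    intro u hu
    have h1 := hb u hu
    have h2 := hmax (p u)
    have h3 := hdpos u
    refine ⟨mul_nonneg (by linarith) (sq_nonneg _), by positivity, mul_nonneg (by linarith) ?_⟩
    have := hy u
    have := hy (p u)
    linarith
  have htot : ∑ u ∈ univ.erase r, (lam * y u ^ 2 + (1 + (d u)⁻¹) * y r ^ 2 -
      ((y u + y (p u)) ^ 2 + 2 * c u * y u ^ 2)) = lam * ∑ v, y v ^ 2 -
      ∑ u ∈ univ.erase r, ((y u + y (p u)) ^ 2 + 2 * c u * y u ^ 2) := by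
    rw [sum_sub_distrib, sum_add_distrib, ← mul_sum, ← sum_mul, hsum,
      ← add_sum_erase _ (fun v => y v ^ 2) (mem_univ r)]
    ring
  have hterm : ∀ u ∈ univ.erase r, 0 ≤ lam * y u ^ 2 + (1 + (d u)⁻¹) * y r ^ 2 -
      ((y u + y (p u)) ^ 2 + 2 * c u * y u ^ 2) := by
    intro u hu
    obtain ⟨h1, h2, h3⟩ := hnn u (ne_of_mem_erase hu)
    rw [hid]; linarith
  have hge := sum_nonneg hterm
  rw [htot] at hge
  refine ⟨le_of_mul_le_mul_right (by linarith) hpos, fun heq => ⟨hr, fun u hu => ?_⟩⟩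
  rw [heq] at hle
  have h0 := (sum_eq_zero_iff_of_nonneg hterm).1 (by rw [htot]; linarith) u
    (mem_erase.2 ⟨hu, mem_univ u⟩)
  rw [hid] at h0
  obtain ⟨h1, h2, h3⟩ := hnn u hu
  have e2 : d u * (y u - (d u)⁻¹ * y r) ^ 2 = 0 := by linarith
  have e1 : 2 * (b u - c u) * y u ^ 2 = 0 := by linarith
  have e3 : (y r - y (p u)) * (2 * y u + y r + y (p u)) = 0 := by linarith
  have hyu : y u = (d u)⁻¹ * y r := by
    have := (mul_eq_zero.1 e2).resolve_left (hdpos u).ne'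
    have := pow_eq_zero_iff (two_ne_zero) |>.1 this
    linarith
  have hyupos : 0 < y u := hyu ▸ mul_pos (inv_pos.2 (hdpos u)) hr
  refine ⟨?_, hyu, ?_⟩
  · have := (mul_eq_zero.1 e1).resolve_right (by positivity)
    linarith
  · have := (mul_eq_zero.1 e3).resolve_right (by have := hy (p u); positivity)
    linarith

end Spectral

/-! ### The extremal graphs -/

section Bundle

variable {V : Type*} [Fintype V] [DecidableEq V] {G : SimpleGraph V} [DecidableRel G.Adj]

/-- If all parents are the root and `b` gives the degrees in the matching of non-parent edges, then
`G` is a bundle whose pendant edges correspond to the zeros of `b`. -/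
theorem nonempty_iso_of_degree_eq {r : V} {p : V → V} {s k : ℕ} {b : V → ℝ}
    [DecidableRel (G.nonParentGraph p).Adj] (hp : G.IsDistParent r p) (hG : G.IsCactus)
    (hpr : ∀ u, u ≠ r → p u = r) (hb : ∀ u, u ≠ r → ((G.nonParentGraph p).degree u : ℝ) = b u)
    (hk : #{u ∈ univ.erase r | b u = 0} = k) (hV : Fintype.card V = 2 * s + k + 1) :
    Nonempty (G ≃g triangleBundle s k) := by
  have hM : ∀ u a, u ≠ r → a ≠ r → ((G.nonParentGraph p).Adj u a ↔ G.Adj u a) := by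
    intro u a hu ha
    refine ⟨fun h => h.1, fun h => ⟨h, ?_, ?_⟩⟩
    · rw [hpr u hu]; exact ha.symm
    · rw [hpr a ha]; exact hu.symm
  refine nonempty_iso_triangleBundle (r := r) (fun u hu => ?_) (fun u a c hu ha hc h1 h2 => ?_) ?_ hV
  · have := (hp u hu).1
    rw [hpr u hu] at this
    exact this.symm
  · exact hG.nonParentGraph_adj_unique hp ((hM u a hu ha).2 h1) ((hM u c hu hc).2 h2)
  · rw [← hk, Nat.card_eq_fintype_card, Fintype.card_subtype]
    congr 1
    ext u
    simp only [mem_filter, mem_univ, true_and, mem_erase, and_true]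
    refine and_congr_right fun hu => ?_
    rw [← hb u hu, Nat.cast_eq_zero, ← card_neighborFinset_eq_degree, Finset.card_eq_zero,
      Finset.eq_empty_iff_forall_notMem]
    simp only [mem_neighborFinset]
    refine ⟨fun h a ha => ?_, fun h a ha hadj => h a ((hM u a hu ha).2 hadj)⟩
    have har : a ≠ r := by
      rintro rfl
      exact hp.not_adj_root hG.1 u ha.symm
    exact h a har ha.1

/-- An eigenvector equation on a bundle of triangles and pendant edges, transported along an
isomorphism. -/
theorem le_signlessLapRadius_of_iso {s k : ℕ} (e : G ≃g triangleBundle s k) {lam α β : ℝ}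
    (h0 : 2 * s * (1 + α) + k * (1 + β) = lam) (h1 : 3 * α + 1 = lam * α) (h2 : β + 1 = lam * β) :
    lam ≤ G.signlessLapRadius := by
  classical
  let f : Option ((Fin s × Bool) ⊕ Fin k) → ℝ
    | none => 1
    | some (.inl _) => α
    | some (.inr _) => β
  have : Nonempty V := ⟨e.symm none⟩
  refine le_signlessLapRadius_of_eigenvector G (x := fun v => f (e v)) ?_ fun v => ?_
  · intro h
    have := congrFun h (e.symm none)
    simp [f] at this
  · have a00 : ¬ (triangleBundle s k).Adj none none := SimpleGraph.irrefl _
    have a01 : ∀ x, (triangleBundle s k).Adj none (some x) := fun _ => trivial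
    have a10 : ∀ x, (triangleBundle s k).Adj (some x) none := fun _ => trivial
    have a11 : ∀ x y, (triangleBundle s k).Adj (some (.inl x)) (some (.inl y)) ↔
        x.1 = y.1 ∧ x.2 ≠ y.2 := fun _ _ => Iff.rfl
    have a12 : ∀ x y, ¬ (triangleBundle s k).Adj (some (.inl x)) (some (.inr y)) := fun _ _ h => h
    have a21 : ∀ x y, ¬ (triangleBundle s k).Adj (some (.inr x)) (some (.inl y)) := fun _ _ h => h
    have a22 : ∀ x y, ¬ (triangleBundle s k).Adj (some (.inr x)) (some (.inr y)) := fun _ _ h => h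
    have key : ∀ a, ∑ c, (if (triangleBundle s k).Adj a c then f a + f c else 0) = lam * f a := by
      rintro (_ | ⟨i, b⟩ | j)
      · simp only [Fintype.sum_option, Fintype.sum_sum_type, a00, a01, f]
        simp only [if_true, if_false, zero_add, sum_const, card_univ, Fintype.card_prod, Fintype.card_fin,
          Fintype.card_bool, nsmul_eq_mul]
        rw [← h0]; push_cast; ring
      · simp only [Fintype.sum_option, Fintype.sum_sum_type, a10, a11, a12, f]
        simp only [if_true, if_false, sum_const_zero, add_zero]
        rw [Fintype.sum_eq_single (i, !b)]
        · rw [if_pos ⟨rfl, by cases b <;> simp⟩, ← h1]; ring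
        · rintro ⟨j, c⟩ hne
          refine if_neg ?_
          rintro ⟨rfl, h⟩
          refine hne ?_
          cases b <;> cases c <;> simp_all
      · simp only [Fintype.sum_option, Fintype.sum_sum_type, a10, a21, a22, f]
        simp only [if_true, if_false, sum_const_zero, add_zero]
        exact h2
    rw [← key (e v), ← e.toEquiv.sum_comp]
    refine sum_congr rfl fun u _ => ?_
    exact if_congr e.map_adj_iff.symm rfl rfl

/-- The common part of the odd and the even case: `k` is the number of vertices which the extremal
matching leaves uncovered. -/
theorem IsCactus.signlessLapRadius_le_and_eq_iff (hG : G.IsCactus) {s k : ℕ} {lam : ℝ}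
    (hk : k ≤ 1) (hV : Fintype.card V = 2 * s + k + 1) (hs : 0 < s)
    (hlam : 4 ≤ lam) (hlam4 : lam = 4 → Fintype.card V ≤ 3)
    (hsum : 2 * s * (1 + (lam - 3)⁻¹) + k * (1 + (lam - 1)⁻¹) = lam) :
    G.signlessLapRadius ≤ lam ∧
      (G.signlessLapRadius = lam ↔ Nonempty (G ≃g triangleBundle s k)) := by
  classical
  have : Nonempty V := Fintype.card_pos_iff.1 (by omega)
  have hback : Nonempty (G ≃g triangleBundle s k) → lam ≤ G.signlessLapRadius := by
    rintro ⟨e⟩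
    refine le_signlessLapRadius_of_iso e hsum ?_ ?_
    · have : lam - 3 ≠ 0 := by linarith
      field_simp
      ring
    · have : lam - 1 ≠ 0 := by linarith
      field_simp
      ring
  obtain ⟨y, hy0, hy, hray⟩ := G.exists_nonneg_rayleigh
  obtain ⟨r, hmax⟩ := Finite.exists_max y
  obtain ⟨p, hp⟩ := hG.1.exists_isDistParent r
  have hdeg := degree_le_one_of_adj_unique (G.nonParentGraph p)
    fun w a b => hG.nonParentGraph_adj_unique hp
  have heven := even_card_degree_eq_one (G.nonParentGraph p) hdeg
  have hr0 : (G.nonParentGraph p).degree r = 0 := by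
    rw [← card_neighborFinset_eq_degree, Finset.card_eq_zero, Finset.eq_empty_iff_forall_notMem]
    intro a ha
    rw [mem_neighborFinset] at ha
    exact hp.not_adj_root hG.1 a ha
  -- Evenly many of the 2s + k non-root vertices are matched and k ≤ 1, so at least k are unmatched.
  obtain ⟨K, hKsub, hKcard⟩ : ∃ K ⊆ {u ∈ univ.erase r | (G.nonParentGraph p).degree u = 0},
      #K = k := by
    refine exists_subset_card_eq ?_
    have h1 := card_filter_add_card_filter_not (s := univ.erase r)
      (fun u => (G.nonParentGraph p).degree u = 0)
    have h2 : ({u ∈ univ.erase r | ¬ (G.nonParentGraph p).degree u = 0} : Finset V) =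
        ({u | (G.nonParentGraph p).degree u = 1} : Finset V) := by
      ext u
      have := hdeg u
      simp only [mem_filter, mem_erase, mem_univ, and_true, true_and]
      constructor
      · omega
      · intro h
        refine ⟨?_, by omega⟩
        rintro rfl
        omega
    rw [h2, card_erase_of_mem (mem_univ r), card_univ] at h1
    obtain ⟨t, ht⟩ := heven
    omega
  have hKne : ∀ u ∈ K, u ≠ r ∧ (G.nonParentGraph p).degree u = 0 := by
    intro u hu
    have := hKsub hu
    simpa using this
  set b : V → ℝ := fun u => if u ∈ K then 0 else 1 with hb
  have hKe : K ⊆ univ.erase r := fun u hu => mem_erase.2 ⟨(hKne u hu).1, mem_univ u⟩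
  have hsumb : ∑ u ∈ univ.erase r, (1 + (lam - 1 - 2 * b u)⁻¹) = lam := by
    rw [← sum_sdiff hKe]
    have e1 : ∑ u ∈ K, (1 + (lam - 1 - 2 * b u)⁻¹) = k * (1 + (lam - 1)⁻¹) := by
      rw [sum_congr rfl (g := fun _ => 1 + (lam - 1)⁻¹), sum_const, hKcard, nsmul_eq_mul]
      intro u hu
      simp [hb, hu]
    have e2 : ∑ u ∈ univ.erase r \ K, (1 + (lam - 1 - 2 * b u)⁻¹) =
        2 * s * (1 + (lam - 3)⁻¹) := by
      rw [sum_congr rfl (g := fun _ => 1 + (lam - 3)⁻¹), sum_const, card_sdiff_of_subset hKe,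
        card_erase_of_mem (mem_univ r), card_univ, hKcard, nsmul_eq_mul]
      · congr 1
        have : Fintype.card V - 1 - k = 2 * s := by omega
        rw [this]; push_cast; rfl
      · intro u hu
        have : u ∉ K := (mem_sdiff.1 hu).2
        simp only [hb, if_neg this]
        congr 2; ring
    rw [e1, e2, hsum]
  have hcb : ∀ u, u ≠ r → ((G.nonParentGraph p).degree u : ℝ) ≤ b u := by
    intro u _
    by_cases hu : u ∈ K
    · simp [hb, hu, (hKne u hu).2]
    · simp only [hb, if_neg hu]
      exact_mod_cast hdeg u
  have hb1 : ∀ u, b u ≤ 1 := by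
    intro u
    simp only [hb]
    split_ifs <;> norm_num
  have hedges := hp.sum_edges_le hG.1 y
  obtain ⟨hle, heq⟩ := eq_of_le_weighted_sum (ρ := G.signlessLapRadius) (p := p) hy0 hy hmax
    (by linarith) hcb hb1 (by linarith) hsumb
  refine ⟨hle, fun h => ?_, fun h => le_antisymm hle (hback h)⟩
  obtain ⟨hrpos, hall⟩ := heq h
  have hpr : ∀ u, u ≠ r → p u = r := by
    intro u hu
    by_contra hpu
    have h1 := (hall u hu).2.2
    have h2 := (hall (p u) hpu).2.1
    rw [h1] at h2
    -- A parent other than r also has the maximal value, so lam = 2 + 2 b (p u) ≤ 4. Hence lam = 4,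
    -- at most three vertices exist, and k = 0; but then u has a matching partner, a fourth vertex.
    have h3 : (lam - 1 - 2 * b (p u))⁻¹ = 1 := by
      refine mul_right_cancel₀ hrpos.ne' ?_
      rw [one_mul]; exact h2.symm
    rw [inv_eq_one] at h3
    have h4 := hb1 (p u)
    have hc3 := hlam4 (by linarith)
    have hk0 : k = 0 := by omega
    have hKe : K = ∅ := by rw [← Finset.card_eq_zero, hKcard, hk0]
    have h5 := (hall u hu).1
    simp only [hb, hKe, notMem_empty, if_false] at h5
    have h6 : (G.nonParentGraph p).degree u = 1 := by exact_mod_cast h5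
    obtain ⟨m, hm⟩ := (degree_pos_iff_exists_adj (G := G.nonParentGraph p) u).1 (by omega)
    have hmr : m ≠ r := by
      rintro rfl
      exact hp.not_adj_root hG.1 u hm.symm
    have h7 : #({r, u, p u, m} : Finset V) = 4 := by
      have a1 := (hp u hu).1.ne
      have a2 := hm.1.ne
      have a3 := hm.2.1
      rw [card_insert_of_notMem, card_insert_of_notMem, card_insert_of_notMem, card_singleton]
      · simpa using a3
      · simp [a1, a2]
      · simp [Ne.symm hu, Ne.symm hpu, Ne.symm hmr]
    have h8 := card_le_univ ({r, u, p u, m} : Finset V)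
    omega
  refine nonempty_iso_of_degree_eq hp hG hpr (fun u hu => (hall u hu).1) ?_ hV
  rw [← hKcard]
  congr 1
  ext u
  by_cases hu : u ∈ K
  · simp [hb, hu, (hKne u hu).1]
  · simp [hb, hu]

end Bundle

end SimpleGraph

/-! ### Closed forms for odd and even n -/

theorem theorem3p2 {V : Type*} [Fintype V] [DecidableEq V] (G : SimpleGraph V)
    [DecidableRel G.Adj] (n : ℕ) (hn : 3 ≤ n) (hcard : Fintype.card V = n)
    (hG : G.IsCactus) :
    (Odd n →
      G.signlessLapRadius ≤ (((n : ℝ) + 2) + √((n : ℝ) ^ 2 - 4 * n + 12)) / 2 ∧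
      (G.signlessLapRadius = (((n : ℝ) + 2) + √((n : ℝ) ^ 2 - 4 * n + 12)) / 2 ↔
        Nonempty (G ≃g SimpleGraph.triangleBundle ((n - 1) / 2) 0))) ∧
    (Even n →
      G.signlessLapRadius ≤ (((n : ℝ) + 1) + √((n : ℝ) ^ 2 - 2 * n + 9)) / 2 ∧
      (G.signlessLapRadius = (((n : ℝ) + 1) + √((n : ℝ) ^ 2 - 2 * n + 9)) / 2 ↔
        Nonempty (G ≃g SimpleGraph.triangleBundle (n / 2 - 1) 1))) := by
  have hn' : (3 : ℝ) ≤ n := by exact_mod_cast hn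
  constructor
  · rintro ⟨s, rfl⟩
    have hs : (2 * s + 1 - 1) / 2 = s := by omega
    rw [hs]
    push_cast at hn' ⊢
    set R := √((2 * (s : ℝ) + 1) ^ 2 - 4 * (2 * s + 1) + 12) with hR
    have hR2 : R ^ 2 = (2 * (s : ℝ) + 1) ^ 2 - 4 * (2 * s + 1) + 12 := by
      rw [hR, Real.sq_sqrt]
      nlinarith [sq_nonneg (2 * (s : ℝ) - 1)]
    have hR3 : 3 ≤ R := Real.le_sqrt_of_sq_le (by nlinarith)
    refine hG.signlessLapRadius_le_and_eq_iff (by omega) (by omega) (by omega) (by linarith) ?_ ?_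
    · intro h
      have h1 : (s : ℝ) ≤ 1 := by nlinarith
      have h2 : s ≤ 1 := by exact_mod_cast h1
      omega
    · have h3 : (2 * (s : ℝ) + 1 + 2 + R) / 2 - 3 ≠ 0 := by
        have : 0 < (2 * (s : ℝ) + 1 + 2 + R) / 2 - 3 := by linarith
        exact this.ne'
      push_cast
      rw [← sub_eq_zero]
      refine mul_right_cancel₀ h3 ?_
      rw [zero_mul, sub_mul, add_mul, mul_assoc, add_mul _ _ ((2 * (s : ℝ) + 1 + 2 + R) / 2 - 3),
        inv_mul_cancel₀ h3]
      linear_combination -hR2 / 4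
  · rintro ⟨t, rfl⟩
    obtain ⟨s, rfl⟩ : ∃ s, t = s + 1 := ⟨t - 1, by omega⟩
    have hs : (s + 1 + (s + 1)) / 2 - 1 = s := by omega
    rw [hs]
    push_cast at hn' ⊢
    set N : ℝ := (s : ℝ) + 1 + (s + 1) with hN
    have hN4 : 4 ≤ N := by
      have : 1 ≤ s := by omega
      have : (1 : ℝ) ≤ s := by exact_mod_cast this
      linarith
    set R := √(N ^ 2 - 2 * N + 9) with hR
    have hR2 : R ^ 2 = N ^ 2 - 2 * N + 9 := by
      rw [hR, Real.sq_sqrt]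
      nlinarith [sq_nonneg (N - 1)]
    have hR3 : 4 ≤ R := Real.le_sqrt_of_sq_le (by nlinarith)
    refine hG.signlessLapRadius_le_and_eq_iff (by omega) (by omega) (by omega) (by linarith) ?_ ?_
    · intro h
      exfalso
      linarith
    · have h3 : (N + 1 + R) / 2 - 3 ≠ 0 := by
        have : 0 < (N + 1 + R) / 2 - 3 := by linarith
        exact this.ne'
      have h1 : (N + 1 + R) / 2 - 1 ≠ 0 := by
        have : 0 < (N + 1 + R) / 2 - 1 := by linarith
        exact this.ne'
      have hs2 : 2 * (s : ℝ) = N - 2 := by rw [hN]; ring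
      rw [hs2]
      set lam := (N + 1 + R) / 2 with hl
      have hquad : lam ^ 2 - (N + 1) * lam + N - 2 = 0 := by
        rw [hl]; linear_combination hR2 / 4
      push_cast
      field_simp
      -- Clearing denominators gives a cubic in lam, with the extra factor lam - 2.
      linear_combination -(lam - 2) * hquad
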